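/- There are absolute constants $C, c > 0$ such that the following holds. Let $a_1,\dots,a_m$ be independent standard Gaussian random vectors in $\mathbb{R}^n$, let $K$ be a subset of the closed unit Euclidean ball of $\mathbb{R}^n$, and fix $x \in K$ with $\|x\|_2 = 1$. Let $y_1,\dots,y_m$ be $\{-1,1\}$-valued random variables that are conditionally independent given $(a_1,\dots,a_m)$ and satisfy $$\mathbb{E}\big[y_i \mid a_1,\dots,a_m\big] = \theta(\langle a_i, x\rangle) \quad \text{almost surely}, \qquad i = 1,\dots,m,$$ for some function $\theta:\mathbb{R}\to\mathbb{R}$ with $\lambda := \mathbb{E}[\theta(g)\, g] > 0$, where $g$ is a standard normal random variable. Let $$w(K) := \mathbb{E} \sup_{z \in K - K} \langle \mathbf{g}, z\rangle$$ be the mean width of $K$, where $\mathbf{g}$ is a standard Gaussian random vector in $\mathbb{R}^n$ and $K-K=\{u-v : u,v\in K\}$. Let $\delta > 0$ and suppose that $m \ge C \delta^{-2} w(K)^2$. Then, with probability at least $1 - 8\exp(-c\,\delta^2 m)$, every solution $\hat{x}$ of the optimization problem $$\max \sum_{i=1}^m y_i \langle a_i, x'\rangle \quad \text{subject to} \quad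 x' \in K$$ satisfies $$\|\hat{x} - x\|_2^2 \le \delta/\lambda.$$ -/

import Mathlib

open MeasureTheory ProbabilityTheory
open scoped Pointwise

/-- The (Gaussian) mean width `w(K) = 𝔼 sup_{z ∈ K - K} ⟨g, z⟩`, with `g` a standard Gaussian
vector in `ℝⁿ` and `K - K` the Minkowski difference. -/
noncomputable def meanWidth {n : ℕ} (K : Set (EuclideanSpace ℝ (Fin n))) : ℝ :=
  ∫ g, sSup ((fun z => inner ℝ g z) '' (K - K)) ∂(stdGaussian (EuclideanSpace ℝ (Fin n)))

/-- The correlation coefficient `𝔼 θ(g) g`, with `g` a standard normal variable. -/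
noncomputable def correlation (θ : ℝ → ℝ) : ℝ :=
  ∫ z, θ z * z ∂(gaussianReal 0 1)

/-- The σ-algebra generated by the measurement vectors `a₁, …, aₘ` jointly. -/
abbrev sigmaOf {Ω : Type*} {n m : ℕ} (a : Fin m → Ω → EuclideanSpace ℝ (Fin n)) :
    MeasurableSpace Ω :=
  MeasurableSpace.comap (fun ω i => a i ω) inferInstance

/-- Mutual conditional independence of the real random variables `y i` given the sub-σ-algebra `𝓖`:
`ℙ(⋂_{i ∈ S} {y i ∈ B i} | 𝓖) = ∏_{i ∈ S} ℙ(y i ∈ B i | 𝓖)` almost surely, for all finite `S` and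
all Borel sets `B i`. Unlike Mathlib's `iCondIndepFun`, this does not require the sample space to
be standard Borel. -/
def CondIndepGiven {Ω ι : Type*} (𝓖 : MeasurableSpace Ω) [MeasurableSpace Ω] (μ : Measure Ω)
    (y : ι → Ω → ℝ) : Prop :=
  ∀ (S : Finset ι) (B : ι → Set ℝ), (∀ i ∈ S, MeasurableSet (B i)) →
    μ[(⋂ i ∈ S, y i ⁻¹' B i).indicator (fun _ => (1 : ℝ)) | 𝓖] =ᵐ[μ]
      fun ω => ∏ i ∈ S, (μ[(y i ⁻¹' B i).indicator (fun _ => (1 : ℝ)) | 𝓖]) ω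

/-- The one-bit measurement model for the signal `x` with response function `θ`: independent
standard Gaussian measurement vectors `a i`, and `{-1, 1}`-valued responses `y i` that are
independent given all the `a j`, with conditional mean `θ ⟨a i, x⟩`. -/
structure OneBitModel {Ω : Type*} [MeasurableSpace Ω] (μ : Measure Ω) {n m : ℕ}
    (a : Fin m → Ω → EuclideanSpace ℝ (Fin n)) (y : Fin m → Ω → ℝ)
    (θ : ℝ → ℝ) (x : EuclideanSpace ℝ (Fin n)) : Prop where
  measurable_a : ∀ i, Measurable (a i)
  measurable_y : ∀ i, Measurable (y i)
  gaussian : ∀ i, HasLaw (a i) (stdGaussian (EuclideanSpace ℝ (Fin n))) μ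
  indep : iIndepFun a μ
  sign_valued : ∀ i, ∀ᵐ ω ∂μ, y i ω = -1 ∨ y i ω = 1
  condIndep : CondIndepGiven (sigmaOf a) μ y
  condMean : ∀ i, μ[y i | sigmaOf a] =ᵐ[μ] fun ω => θ (inner ℝ (a i ω) x)

/-- `xhat` solves the program: maximize `∑ i, b i * ⟨v i, x'⟩` subject to `x' ∈ K`. -/
def IsSolution {n m : ℕ} (K : Set (EuclideanSpace ℝ (Fin n)))
    (v : Fin m → EuclideanSpace ℝ (Fin n)) (b : Fin m → ℝ)
    (xhat : EuclideanSpace ℝ (Fin n)) : Prop :=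
  xhat ∈ K ∧ ∀ x' ∈ K, ∑ i, b i * inner ℝ (v i) x' ≤ ∑ i, b i * inner ℝ (v i) xhat

/-! Write `λ = correlation θ` and `W = ∑ (y i • a i - λ • x)`. Conditioning on the `a j` and
reflecting in the line `ℝ ∙ x` gives `𝔼[y i • a i] = λ • x`, so `W` is a sum of independent centered
vectors. If the support function `h` of `K - K` satisfies `h(W) ≤ m δ / 2`, testing against `xhat -
x` and using optimality gives `λ (1 - ⟨x, xhat⟩) ≤ δ / 2`. Since `‖xhat‖ ≤ 1 = ‖x‖`, this bounds
`‖xhat - x‖²` by `δ / λ` (`IsSolution.norm_sub_sq_le`).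

It remains to bound the upper tail of `h(W)`. Each `y i • a i` is a standard Gaussian vector up to a
random sign, which may depend on it. Centering and a midpoint argument show that each summand is
dominated in the convex order by `2 • g`. This order is preserved by convolution, so `W` is
dominated by `(2 √m) • g` (`convexDominated_sum`). For `s ≥ 0` the function `exp (s h)` is convex,
hence `𝔼 exp (s h(W)) ≤ 𝔼 exp (2 s √m h(g))`.

The Gaussian moment is controlled by the rotation argument of Maurey and Pisier, applied to smooth
approximations of `h` (`integral_exp_supportFunction_le`). The mean of `h(g)` is exactly `meanWidth
K`, and the variance term depends only on the radius 2 of `K - K`. Chernoff's bound with the optimal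
`s` concludes. -/

/-! ### Continuous functions of exponential growth. -/

section ExpGrowth

variable {E : Type*} [NormedAddCommGroup E]

/-- Continuous functions of at most exponential growth. -/
structure ExpGrowth (Φ : E → ℝ) : Prop where
  continuous : Continuous Φ
  bound : ∃ A B : ℝ, ∀ u, |Φ u| ≤ A * Real.exp (B * ‖u‖)

theorem ExpGrowth.exists_bound_nonneg {Φ : E → ℝ} (hΦ : ExpGrowth Φ) :
    ∃ A B : ℝ, 0 ≤ A ∧ 0 ≤ B ∧ ∀ u, |Φ u| ≤ A * Real.exp (B * ‖u‖) := by
  obtain ⟨A, B, h⟩ := hΦ.bound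
  have hA : 0 ≤ A := by simpa using (abs_nonneg _).trans (h 0)
  refine ⟨A, |B|, hA, abs_nonneg B, fun u => (h u).trans ?_⟩
  gcongr
  exact le_abs_self B

theorem expGrowth_exp_norm (B : ℝ) : ExpGrowth fun x : E => Real.exp (B * ‖x‖) :=
  ⟨by fun_prop, 1, B, fun u => by simp⟩

theorem ExpGrowth.integrable [MeasurableSpace E] [BorelSpace E]
    [SecondCountableTopology E] {Φ : E → ℝ} (hΦ : ExpGrowth Φ)
    {μ : Measure E}
    (hμ : ∀ B : ℝ, Integrable (fun x => Real.exp (B * ‖x‖)) μ) : Integrable Φ μ := by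
  obtain ⟨A, B, h⟩ := hΦ.bound
  exact ((hμ B).const_mul A).mono' hΦ.continuous.aestronglyMeasurable (ae_of_all _ h)

variable [InnerProductSpace ℝ E]

theorem ExpGrowth.comp_add_smul {Φ : E → ℝ} (hΦ : ExpGrowth Φ) (u : E) (c : ℝ) :
    ExpGrowth fun x => Φ (u + c • x) := by
  obtain ⟨A, B, hA, hB, h⟩ := hΦ.exists_bound_nonneg
  refine ⟨hΦ.continuous.comp (by fun_prop), A * Real.exp (B * ‖u‖), B * |c|, fun x => ?_⟩
  refine (h _).trans ?_
  rw [mul_assoc, ← Real.exp_add]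
  gcongr
  have : ‖u + c • x‖ ≤ ‖u‖ + |c| * ‖x‖ := by
    simpa [norm_smul] using norm_add_le u (c • x)
  nlinarith

theorem convexOn_comp_add_smul {Φ : E → ℝ} (hΦ : ConvexOn ℝ Set.univ Φ) (u : E) (c : ℝ) :
    ConvexOn ℝ Set.univ fun x => Φ (u + c • x) := by
  refine ⟨convex_univ, fun x _ y _ a b ha hb hab => ?_⟩
  have h := hΦ.2 (Set.mem_univ (u + c • x)) (Set.mem_univ (u + c • y)) ha hb hab
  refine le_of_eq_of_le (congrArg Φ ?_) h
  obtain rfl : b = 1 - a := by linarith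
  module

end ExpGrowth

/-! ### Interpolation along a rotation between two points. -/

section RotationPath

variable {E : Type*} [NormedAddCommGroup E] [InnerProductSpace ℝ E]

theorem continuous_rotation_apply (p : E × E) :
    Continuous fun t : ℝ => ContinuousLinearMap.rotation (E := E) (Real.pi / 2 * t) p := by
  simp only [ContinuousLinearMap.rotation_apply]
  fun_prop

theorem hasDerivAt_comp_rotation_fst [CompleteSpace E] {F : E → ℝ} {F' : E → E}
    (hF : ∀ x, HasGradientAt F (F' x) x) (p : E × E) (t : ℝ) :
    HasDerivAt (fun t : ℝ => F (ContinuousLinearMap.rotation (Real.pi / 2 * t) p).1)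
      (Real.pi / 2 * inner ℝ (F' (ContinuousLinearMap.rotation (Real.pi / 2 * t) p).1)
        (ContinuousLinearMap.rotation (Real.pi / 2 * t) p).2) t := by
  have h1 : HasDerivAt (fun t : ℝ => (ContinuousLinearMap.rotation (Real.pi / 2 * t) p).1)
      ((Real.pi / 2) • (ContinuousLinearMap.rotation (Real.pi / 2 * t) p).2) t := by
    simp only [ContinuousLinearMap.rotation_apply]
    have hl : HasDerivAt (fun t : ℝ => Real.pi / 2 * t) (Real.pi / 2) t := by
      simpa using (hasDerivAt_id t).const_mul (Real.pi / 2)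
    convert! (hl.cos.smul_const p.1).add (hl.sin.smul_const p.2) using 1
    module
  have h2 := (hF (ContinuousLinearMap.rotation (Real.pi / 2 * t) p).1).hasFDerivAt.comp_hasDerivAt
    t h1
  rw [InnerProductSpace.toDual_apply_apply, inner_smul_right] at h2
  exact h2

/-- The first component of the rotated pair runs from `p.1` to `p.2`, and its velocity is `π / 2`
times the second component. The increment of `F` is thus an average over `t` in `(0, 1]`, and
Jensen's inequality moves the exponential inside. -/
theorem exp_sub_le_integral_rotation [CompleteSpace E] {F : E → ℝ} {F' : E → E}
    (hF : ∀ x, HasGradientAt F (F' x) x) (hF' : Continuous F') (s : ℝ) (p : E × E) :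
    Real.exp (s * (F p.2 - F p.1)) ≤
      ∫ t in Set.Ioc (0 : ℝ) 1, Real.exp (s * (Real.pi / 2) *
        inner ℝ (F' (ContinuousLinearMap.rotation (Real.pi / 2 * t) p).1)
          (ContinuousLinearMap.rotation (Real.pi / 2 * t) p).2) := by
  have : IsProbabilityMeasure (volume.restrict (Set.Ioc (0 : ℝ) 1)) := ⟨by simp⟩
  have hR := continuous_rotation_apply p
  have hftc := intervalIntegral.integral_eq_sub_of_hasDerivAt (a := 0) (b := 1)
    (fun t _ => hasDerivAt_comp_rotation_fst hF p t)
    (Continuous.intervalIntegrable (by fun_prop) _ _)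
  rw [intervalIntegral.integral_of_le zero_le_one] at hftc
  have h01 : s * (F p.2 - F p.1) = ∫ t in Set.Ioc (0 : ℝ) 1, s * (Real.pi / 2) *
        inner ℝ (F' (ContinuousLinearMap.rotation (Real.pi / 2 * t) p).1)
          (ContinuousLinearMap.rotation (Real.pi / 2 * t) p).2 := by
    simp only [mul_assoc s]
    rw [integral_const_mul, hftc]
    simp [ContinuousLinearMap.rotation_apply]
  have hcont : Continuous fun t : ℝ => s * (Real.pi / 2) *
      inner ℝ (F' (ContinuousLinearMap.rotation (Real.pi / 2 * t) p).1)
        (ContinuousLinearMap.rotation (Real.pi / 2 * t) p).2 := by fun_prop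
  rw [h01]
  refine convexOn_exp.map_integral_le Real.continuous_exp.continuousOn isClosed_univ
    (by simp) ?_ ?_
  · exact (hcont.integrableOn_Icc (a := 0) (b := 1)).mono_set Set.Ioc_subset_Icc_self
  · exact ((Real.continuous_exp.comp hcont).integrableOn_Icc (a := 0) (b := 1)).mono_set
      Set.Ioc_subset_Icc_self

end RotationPath

/-! ### Gaussian exponential moments and the Maurey–Pisier inequality. -/

section GaussianConcentration

variable {E : Type*} [NormedAddCommGroup E] [InnerProductSpace ℝ E] [FiniteDimensional ℝ E]
  [MeasurableSpace E] [BorelSpace E]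

/-- A Gaussian measure has exponential moments of the norm of every order. -/
theorem integrable_exp_mul_norm_of_isGaussian (μ : Measure E) [IsGaussian μ] (B : ℝ) :
    Integrable (fun x => Real.exp (B * ‖x‖)) μ := by
  obtain ⟨C, hC, hint⟩ := IsGaussian.exists_integrable_exp_sq μ
  refine (hint.const_mul (Real.exp (B ^ 2 / (4 * C)))).mono' (by fun_prop) (ae_of_all _ fun x => ?_)
  rw [Real.norm_eq_abs, Real.abs_exp, ← Real.exp_add]
  apply Real.exp_le_exp.2
  -- Completing the square reduces linear exponents to the square-exponential moment given by
  -- Fernique's theorem.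
  have h : B ^ 2 / (4 * C) + C * ‖x‖ ^ 2 - B * ‖x‖ = (B - 2 * C * ‖x‖) ^ 2 / (4 * C) := by
    field_simp; ring
  have : 0 ≤ (B - 2 * C * ‖x‖) ^ 2 / (4 * C) := by positivity
  linarith

theorem map_inner_stdGaussian (v : E) :
    (stdGaussian E).map (fun y => inner ℝ v y) = gaussianReal 0 (‖v‖₊ ^ 2) := by
  have h := IsGaussian.map_eq_gaussianReal (μ := stdGaussian E) (innerSL ℝ v)
  rw [integral_strongDual_stdGaussian, variance_dual_stdGaussian, innerSL_apply_norm] at h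
  have e : (‖v‖ ^ 2).toNNReal = ‖v‖₊ ^ 2 := by
    ext; simp
  rw [e] at h
  exact h

theorem integral_exp_inner_stdGaussian (v : E) :
    ∫ y, Real.exp (inner ℝ v y) ∂(stdGaussian E) = Real.exp (‖v‖ ^ 2 / 2) := by
  have h := mgf_gaussianReal (map_inner_stdGaussian v) 1
  simpa [mgf] using h

/-- Maurey–Pisier: exponential integrability of a function with bounded gradient under the
standard Gaussian measure. -/
theorem integral_exp_le_of_gradient_bound {F : E → ℝ} {F' : E → E} {L : ℝ}
    (hF : ∀ x, HasGradientAt F (F' x) x) (hF' : Continuous F') (hL : ∀ x, ‖F' x‖ ≤ L)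
    (hFi : Integrable F (stdGaussian E))
    (hFe : ∀ s : ℝ, Integrable (fun x => Real.exp (s * F x)) (stdGaussian E)) (s : ℝ) :
    ∫ x, Real.exp (s * F x) ∂(stdGaussian E) ≤
      Real.exp (s * ∫ x, F x ∂(stdGaussian E) + s ^ 2 * Real.pi ^ 2 * L ^ 2 / 8) := by
  set γ := stdGaussian E with hγ
  have hL0 : 0 ≤ L := (norm_nonneg _).trans (hL 0)
  have hFc : Continuous F := continuous_iff_continuousAt.2 fun x => (hF x).continuousAt
  set R : ℝ → E × E →L[ℝ] E × E := fun t => ContinuousLinearMap.rotation (Real.pi / 2 * t) with hR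
  set G : E × E → ℝ := fun p => Real.exp (s * (Real.pi / 2) * inner ℝ (F' p.1) p.2) with hG
  set ρ : Measure ℝ := volume.restrict (Set.Ioc 0 1) with hρ
  have : IsProbabilityMeasure ρ := ⟨by simp [hρ]⟩
  have hGc : Continuous G := by fun_prop
  have hRc : Continuous fun q : (E × E) × ℝ => R q.2 q.1 := by
    simp only [hR, ContinuousLinearMap.rotation_apply]
    fun_prop
  have hRb : ∀ t (p : E × E), ‖(R t p).2‖ ≤ ‖p.1‖ + ‖p.2‖ := by
    intro t p
    simp only [hR, ContinuousLinearMap.rotation_apply]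
    refine (norm_add_le _ _).trans ?_
    rw [norm_smul, norm_smul, norm_neg]
    gcongr
    · exact mul_le_of_le_one_left (norm_nonneg _) (Real.abs_sin_le_one _)
    · exact mul_le_of_le_one_left (norm_nonneg _) (Real.abs_cos_le_one _)
  have hGb : ∀ t (p : E × E), G (R t p) ≤
      Real.exp (|s| * (Real.pi / 2) * L * ‖p.1‖) * Real.exp (|s| * (Real.pi / 2) * L * ‖p.2‖) := by
    intro t p
    rw [← Real.exp_add]
    apply Real.exp_le_exp.2
    calc s * (Real.pi / 2) * inner ℝ (F' (R t p).1) (R t p).2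
        ≤ |s * (Real.pi / 2) * inner ℝ (F' (R t p).1) (R t p).2| := le_abs_self _
      _ = |s| * (Real.pi / 2) * |inner ℝ (F' (R t p).1) (R t p).2| := by
          rw [abs_mul, abs_mul, abs_of_pos (a := Real.pi / 2) (by positivity)]
      _ ≤ |s| * (Real.pi / 2) * (L * (‖p.1‖ + ‖p.2‖)) := by
          gcongr
          refine (abs_real_inner_le_norm _ _).trans ?_
          gcongr
          · exact hL _
          · exact hRb t p
      _ = _ := by ring
  have hbi : Integrable (fun p : E × E => Real.exp (|s| * (Real.pi / 2) * L * ‖p.1‖) *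
      Real.exp (|s| * (Real.pi / 2) * L * ‖p.2‖)) (γ.prod γ) :=
    (integrable_exp_mul_norm_of_isGaussian γ _).mul_prod
      (integrable_exp_mul_norm_of_isGaussian γ _)
  have hGi : Integrable (fun q : (E × E) × ℝ => G (R q.2 q.1)) ((γ.prod γ).prod ρ) := by
    refine (hbi.comp_fst ρ).mono' (hGc.comp hRc).aestronglyMeasurable (ae_of_all _ fun q => ?_)
    rw [Real.norm_eq_abs, abs_of_pos (Real.exp_pos _)]
    exact hGb q.2 q.1
  have hGi0 : Integrable G (γ.prod γ) := by
    refine hbi.mono' hGc.aestronglyMeasurable (ae_of_all _ fun p => ?_)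
    rw [Real.norm_eq_abs, abs_of_pos (Real.exp_pos _)]
    simpa [hR, ContinuousLinearMap.rotation_apply] using hGb 0 p
  -- The law of two independent centered Gaussian copies is rotation invariant, so every time `t` on
  -- the path contributes the same integral.
  have hrot : ∀ t, ∫ p, G (R t p) ∂(γ.prod γ) = ∫ p, G p ∂(γ.prod γ) := by
    intro t
    have h := IsGaussian.map_rotation_eq_self (μ := γ) (by simp [hγ]) (Real.pi / 2 * t)
    conv_rhs => rw [← h]
    rw [integral_map (by fun_prop) hGc.aestronglyMeasurable]
  have hGint : ∫ p, G p ∂(γ.prod γ) ≤ Real.exp (s ^ 2 * Real.pi ^ 2 * L ^ 2 / 8) := by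
    rw [integral_prod _ hGi0]
    have h1 : ∀ x, ∫ y, G (x, y) ∂γ ≤ Real.exp (s ^ 2 * Real.pi ^ 2 * L ^ 2 / 8) := by
      intro x
      -- With the first coordinate frozen, `G` is the exponential of a linear form in the second, of
      -- norm at most `|s| (π / 2) L`; this is the source of `π² / 8`.
      have := integral_exp_inner_stdGaussian ((s * (Real.pi / 2)) • F' x)
      simp only [inner_smul_left, RCLike.conj_to_real] at this
      simp only [hG]
      rw [hγ, this]
      apply Real.exp_le_exp.2
      rw [norm_smul, mul_pow, Real.norm_eq_abs, sq_abs]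
      have : ‖F' x‖ ^ 2 ≤ L ^ 2 := by gcongr; exact hL x
      nlinarith [mul_le_mul_of_nonneg_left this (sq_nonneg (s * Real.pi))]
    calc _ ≤ ∫ _, Real.exp (s ^ 2 * Real.pi ^ 2 * L ^ 2 / 8) ∂γ :=
          integral_mono hGi0.integral_prod_left (integrable_const _) h1
      _ = _ := by simp
  have hpath : ∀ p : E × E, Real.exp (s * (F p.2 - F p.1)) ≤ ∫ t, G (R t p) ∂ρ :=
    exp_sub_le_integral_rotation hF hF' s
  have hprod : ∫ p : E × E, Real.exp (s * (F p.2 - F p.1)) ∂(γ.prod γ) =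
      (∫ x, Real.exp (-s * F x) ∂γ) * ∫ x, Real.exp (s * F x) ∂γ := by
    rw [← integral_prod_mul]
    congr 1
    ext p
    rw [← Real.exp_add]
    ring_nf
  have hprodi : Integrable (fun p : E × E => Real.exp (s * (F p.2 - F p.1))) (γ.prod γ) := by
    refine ((hFe (-s)).mul_prod (hFe s)).congr (ae_of_all _ fun p => ?_)
    simp only
    rw [← Real.exp_add]
    ring_nf
  have hup : (∫ x, Real.exp (-s * F x) ∂γ) * ∫ x, Real.exp (s * F x) ∂γ ≤
      Real.exp (s ^ 2 * Real.pi ^ 2 * L ^ 2 / 8) := by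
    rw [← hprod]
    calc _ ≤ ∫ p, ∫ t, G (R t p) ∂ρ ∂(γ.prod γ) :=
          integral_mono hprodi hGi.integral_prod_left hpath
      _ = ∫ t, ∫ p, G (R t p) ∂(γ.prod γ) ∂ρ := integral_integral_swap hGi
      _ = ∫ p, G p ∂(γ.prod γ) := by simp [hrot]
      _ ≤ _ := hGint
  -- Jensen's inequality replaces the independent copy by its mean, turning the bound on the
  -- difference of two copies into one centered at the expectation.
  have hjen : Real.exp (-s * ∫ x, F x ∂γ) ≤ ∫ x, Real.exp (-s * F x) ∂γ := by
    rw [← integral_const_mul]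
    exact convexOn_exp.map_integral_le Real.continuous_exp.continuousOn isClosed_univ
      (by simp) (hFi.const_mul _) (hFe _)
  have hpos : 0 ≤ ∫ x, Real.exp (s * F x) ∂γ := integral_nonneg fun _ => (Real.exp_pos _).le
  have h := (mul_le_mul_of_nonneg_right hjen hpos).trans hup
  rw [Real.exp_add]
  calc ∫ x, Real.exp (s * F x) ∂γ
      = Real.exp (s * ∫ x, F x ∂γ) *
        (Real.exp (-s * ∫ x, F x ∂γ) * ∫ x, Real.exp (s * F x) ∂γ) := by
        rw [← mul_assoc, ← Real.exp_add]; simp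
    _ ≤ _ := by gcongr

end GaussianConcentration

/-! ### Smooth approximation of a maximum of linear forms. -/

section SoftMax

variable {E : Type*} [NormedAddCommGroup E] [InnerProductSpace ℝ E]

/-- A smooth approximation of the maximum of the linear forms `⟨·, z 0⟩, …, ⟨·, z k⟩`. -/
noncomputable def softMax (z : ℕ → E) (k : ℕ) (u : E) : ℝ :=
  ((k : ℝ) + 1)⁻¹ * Real.log (∑ i ∈ Finset.range (k + 1), Real.exp ((k + 1) * inner ℝ (z i) u))

/-- The gradient of `softMax`, a convex combination of `z 0, …, z k`. -/
noncomputable def softMaxGradient (z : ℕ → E) (k : ℕ) (u : E) : E :=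
  (∑ i ∈ Finset.range (k + 1), Real.exp ((k + 1) * inner ℝ (z i) u))⁻¹ •
    ∑ i ∈ Finset.range (k + 1), Real.exp ((k + 1) * inner ℝ (z i) u) • z i

theorem sum_exp_inner_pos (z : ℕ → E) (k : ℕ) (u : E) :
    0 < ∑ i ∈ Finset.range (k + 1), Real.exp ((k + 1) * inner ℝ (z i) u) :=
  Finset.sum_pos (fun _ _ => Real.exp_pos _) (by simp)

theorem continuous_softMaxGradient (z : ℕ → E) (k : ℕ) : Continuous (softMaxGradient z k) := by
  unfold softMaxGradient
  exact (Continuous.inv₀ (by fun_prop) fun u => (sum_exp_inner_pos z k u).ne').smul (by fun_prop)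

theorem continuous_softMax (z : ℕ → E) (k : ℕ) : Continuous (softMax z k) := by
  unfold softMax
  exact continuous_const.mul (Continuous.log (by fun_prop) fun u => (sum_exp_inner_pos z k u).ne')

theorem hasGradientAt_softMax [CompleteSpace E] (z : ℕ → E) (k : ℕ) (u : E) :
    HasGradientAt (softMax z k) (softMaxGradient z k u) u := by
  have hk : (k : ℝ) + 1 ≠ 0 := by positivity
  have hin : ∀ i, HasFDerivAt (fun u => inner ℝ (z i) u) (innerSL ℝ (z i)) u := fun i =>
    (innerSL ℝ (z i)).hasFDerivAt
  have h1 : HasFDerivAt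
      (fun u => ∑ i ∈ Finset.range (k + 1), Real.exp ((k + 1) * inner ℝ (z i) u))
      (∑ i ∈ Finset.range (k + 1),
        Real.exp ((k + 1) * inner ℝ (z i) u) • (((k : ℝ) + 1) • innerSL ℝ (z i))) u :=
    HasFDerivAt.fun_sum fun i _ => ((hin i).const_mul _).exp
  have h2 := (h1.log (sum_exp_inner_pos z k u).ne').const_mul ((k : ℝ) + 1)⁻¹
  rw [hasGradientAt_iff_hasFDerivAt]
  refine h2.congr_fderiv ?_
  ext w
  simp only [smul_apply, sum_apply, innerSL_apply_apply,
    smul_eq_mul, InnerProductSpace.toDual_apply_apply, softMaxGradient, inner_smul_left, sum_inner,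
    RCLike.conj_to_real]
  rw [← mul_assoc, mul_comm _ (_⁻¹), mul_assoc, Finset.mul_sum]
  congr 1
  refine Finset.sum_congr rfl fun i _ => ?_
  field_simp

theorem norm_softMaxGradient_le {z : ℕ → E} {L : ℝ} (hz : ∀ i, ‖z i‖ ≤ L) (k : ℕ) (u : E) :
    ‖softMaxGradient z k u‖ ≤ L := by
  have hpos := sum_exp_inner_pos z k u
  rw [softMaxGradient, norm_smul, norm_inv, Real.norm_of_nonneg hpos.le, inv_mul_le_iff₀ hpos,
    Finset.sum_mul]
  refine norm_sum_le_of_le _ fun i _ => ?_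
  rw [norm_smul, Real.norm_of_nonneg (Real.exp_pos _).le]
  exact mul_le_mul_of_nonneg_left (hz i) (Real.exp_pos _).le

theorem inner_le_softMax (z : ℕ → E) {k i : ℕ} (hi : i ≤ k) (u : E) :
    inner ℝ (z i) u ≤ softMax z k u := by
  rw [softMax, le_inv_mul_iff₀ (by positivity), Real.le_log_iff_exp_le (sum_exp_inner_pos z k u)]
  exact Finset.single_le_sum (f := fun i => Real.exp ((k + 1) * inner ℝ (z i) u))
    (fun _ _ => (Real.exp_pos _).le) (Finset.mem_range.2 (Nat.lt_succ_of_le hi))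

/-- The inverse temperature and the number of forms are both `k + 1`, so the overshoot `log (k + 1)
/ (k + 1)` vanishes as more forms are included. -/
theorem softMax_le {z : ℕ → E} {u : E} {M : ℝ} (h : ∀ i, inner ℝ (z i) u ≤ M) (k : ℕ) :
    softMax z k u ≤ M + Real.log (k + 1) / (k + 1) := by
  have hk : (0 : ℝ) < k + 1 := by positivity
  rw [softMax, inv_mul_le_iff₀ hk, mul_add, mul_div_cancel₀ _ hk.ne',
    Real.log_le_iff_le_exp (sum_exp_inner_pos z k u), Real.exp_add, Real.exp_log hk]
  calc _ ≤ ∑ i ∈ Finset.range (k + 1), Real.exp ((k + 1) * M) :=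
        Finset.sum_le_sum fun i _ => Real.exp_le_exp.2 (mul_le_mul_of_nonneg_left (h i) hk.le)
    _ = _ := by simp [mul_comm]

theorem abs_softMax_le {z : ℕ → E} {L : ℝ} (hz : ∀ i, ‖z i‖ ≤ L) (k : ℕ) (u : E) :
    |softMax z k u| ≤ L * ‖u‖ + 1 := by
  have hin : ∀ i, |inner ℝ (z i) u| ≤ L * ‖u‖ := fun i =>
    (abs_real_inner_le_norm _ _).trans (mul_le_mul_of_nonneg_right (hz i) (norm_nonneg _))
  have hk : (0 : ℝ) < k + 1 := by positivity
  have hlog : Real.log (k + 1) / (k + 1) ≤ 1 := by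
    rw [div_le_one hk]
    linarith [Real.log_le_sub_one_of_pos hk]
  rw [abs_le]
  constructor
  · linarith [(abs_le.1 (hin 0)).1, inner_le_softMax z (Nat.zero_le k) u]
  · linarith [softMax_le (fun i => (abs_le.1 (hin i)).2) k]

end SoftMax

/-! ### Support functions of bounded sets and their Gaussian moments. -/

section SupportFunction

variable {E : Type*} [NormedAddCommGroup E] [InnerProductSpace ℝ E]

/-- The support function of the set `S`. -/
noncomputable def supportFunction (S : Set E) (u : E) : ℝ :=
  sSup ((fun z => inner ℝ u z) '' S)

variable {S : Set E} {L : ℝ}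

theorem inner_le_of_subset_closedBall (hS : S ⊆ Metric.closedBall 0 L) (u : E) {z : E}
    (hz : z ∈ S) : |inner ℝ u z| ≤ L * ‖u‖ := by
  have : ‖z‖ ≤ L := by simpa using hS hz
  calc _ ≤ ‖u‖ * ‖z‖ := abs_real_inner_le_norm _ _
    _ ≤ ‖u‖ * L := by gcongr
    _ = _ := mul_comm _ _

theorem inner_le_supportFunction (hS : S ⊆ Metric.closedBall 0 L) (u : E) {z : E} (hz : z ∈ S) :
    inner ℝ u z ≤ supportFunction S u := by
  refine le_csSup ⟨L * ‖u‖, ?_⟩ ⟨z, hz, rfl⟩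
  rintro _ ⟨w, hw, rfl⟩
  exact (abs_le.1 (inner_le_of_subset_closedBall hS u hw)).2

theorem supportFunction_le (hne : S.Nonempty) {u : E} {M : ℝ} (h : ∀ z ∈ S, inner ℝ u z ≤ M) :
    supportFunction S u ≤ M := by
  refine csSup_le (hne.image _) ?_
  rintro _ ⟨w, hw, rfl⟩
  exact h w hw

theorem abs_supportFunction_le (hne : S.Nonempty) (hS : S ⊆ Metric.closedBall 0 L) (u : E) :
    |supportFunction S u| ≤ L * ‖u‖ := by
  obtain ⟨z, hz⟩ := hne
  rw [abs_le]
  refine ⟨?_, supportFunction_le ⟨z, hz⟩ fun w hw =>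
    (abs_le.1 (inner_le_of_subset_closedBall hS u hw)).2⟩
  exact (abs_le.1 (inner_le_of_subset_closedBall hS u hz)).1.trans
    (inner_le_supportFunction hS u hz)

theorem supportFunction_add_le (hne : S.Nonempty) (hS : S ⊆ Metric.closedBall 0 L) (u v : E) :
    supportFunction S (u + v) ≤ supportFunction S u + supportFunction S v := by
  refine supportFunction_le hne fun z hz => ?_
  rw [inner_add_left]
  exact add_le_add (inner_le_supportFunction hS u hz) (inner_le_supportFunction hS v hz)

theorem supportFunction_smul {c : ℝ} (hc : 0 ≤ c) (S : Set E) (u : E) :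
    supportFunction S (c • u) = c * supportFunction S u := by
  have h : (fun z => inner ℝ (c • u) z) '' S = c • ((fun z => inner ℝ u z) '' S) := by
    rw [← Set.image_smul, Set.image_image]
    simp [real_inner_smul_left]
  rw [supportFunction, h, Real.sSup_smul_of_nonneg hc, smul_eq_mul, supportFunction]

theorem continuous_supportFunction (hne : S.Nonempty) (hS : S ⊆ Metric.closedBall 0 L) :
    Continuous (supportFunction S) := by
  have hL : 0 ≤ L := by
    obtain ⟨z, hz⟩ := hne
    exact (norm_nonneg z).trans (by simpa using hS hz)
  have h : ∀ u v : E, supportFunction S u ≤ supportFunction S v + L * dist u v := by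
    intro u v
    have h1 := supportFunction_add_le hne hS v (u - v)
    have h2 := (abs_le.1 (abs_supportFunction_le hne hS (u - v))).2
    rw [add_sub_cancel] at h1
    rw [dist_eq_norm]
    linarith
  exact (LipschitzWith.of_le_add_mul (⟨L, hL⟩ : NNReal) h).continuous

theorem convexOn_supportFunction (hne : S.Nonempty) (hS : S ⊆ Metric.closedBall 0 L) :
    ConvexOn ℝ Set.univ (supportFunction S) := by
  refine ⟨convex_univ, fun u _ v _ a b ha hb _ => ?_⟩
  rw [smul_eq_mul, smul_eq_mul, ← supportFunction_smul ha, ← supportFunction_smul hb]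
  exact supportFunction_add_le hne hS _ _

/-- From below, a near-maximizer in `S` can be replaced by some `z i` by density, and `softMax z k`
dominates that form once `k ≥ i`. From above, the overshoot of `softMax_le` tends to zero. -/
theorem tendsto_softMax_supportFunction (hS : S ⊆ Metric.closedBall 0 L) {z : ℕ → E}
    (hz : ∀ i, z i ∈ S) (hd : S ⊆ closure (Set.range z)) (u : E) :
    Filter.Tendsto (fun k => softMax z k u) Filter.atTop (nhds (supportFunction S u)) := by
  have hne : S.Nonempty := ⟨z 0, hz 0⟩
  refine tendsto_order.2 ⟨fun c hc => ?_, fun c hc => ?_⟩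
  · obtain ⟨_, ⟨w, hw, rfl⟩, hcw⟩ := exists_lt_of_lt_csSup (hne.image _) hc
    have hopen : IsOpen {w : E | c < inner ℝ u w} :=
      isOpen_lt continuous_const (by fun_prop)
    obtain ⟨_, hx, ⟨i, rfl⟩⟩ := mem_closure_iff.1 (hd hw) _ hopen hcw
    filter_upwards [Filter.eventually_ge_atTop i] with k hk
    refine lt_of_lt_of_le ?_ (inner_le_softMax z hk u)
    rw [real_inner_comm]
    exact hx
  · have hlog : Filter.Tendsto (fun k : ℕ => supportFunction S u + Real.log (k + 1) / (k + 1))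
        Filter.atTop (nhds (supportFunction S u)) := by
      have h1 : Filter.Tendsto (fun x : ℝ => Real.log x / x) Filter.atTop (nhds 0) := by
        simpa using (Real.isLittleO_log_id_atTop).tendsto_div_nhds_zero
      have h2 : Filter.Tendsto (fun k : ℕ => (k : ℝ) + 1) Filter.atTop Filter.atTop :=
        Filter.tendsto_atTop_add_const_right _ _ tendsto_natCast_atTop_atTop
      simpa using (h1.comp h2).const_add (supportFunction S u)
    filter_upwards [hlog.eventually_lt_const hc] with k hk
    refine (softMax_le (fun i => ?_) k).trans_lt hk
    rw [real_inner_comm]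
    exact inner_le_supportFunction hS u (hz i)

variable [FiniteDimensional ℝ E] [MeasurableSpace E] [BorelSpace E]

/-- Exponential moments of the supremum of a Gaussian process indexed by a bounded set. -/
theorem integral_exp_supportFunction_le (hne : S.Nonempty) (hS : S ⊆ Metric.closedBall 0 L)
    (s : ℝ) :
    ∫ g, Real.exp (s * supportFunction S g) ∂(stdGaussian E) ≤
      Real.exp (s * ∫ g, supportFunction S g ∂(stdGaussian E) +
        s ^ 2 * Real.pi ^ 2 * L ^ 2 / 8) := by
  -- The support function need not be differentiable, so the inequality is proved for the soft
  -- maxima of a dense sequence. Their gradients are convex combinations of points of `S`, so the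
  -- bound `L` is uniform in `k` and dominated convergence applies.
  have : Nonempty S := hne.to_subtype
  obtain ⟨z', hz'⟩ := TopologicalSpace.exists_dense_seq S
  set z : ℕ → E := fun i => z' i with hzdef
  have hz : ∀ i, z i ∈ S := fun i => (z' i).2
  have hd : S ⊆ closure (Set.range z) := by
    intro w hw
    have h := image_closure_subset_closure_image continuous_subtype_val
      (Set.mem_image_of_mem Subtype.val (hz' ⟨w, hw⟩))
    rwa [← Set.range_comp] at h
  have hzn : ∀ i, ‖z i‖ ≤ L := fun i => by simpa using hS (hz i)
  have hlim := tendsto_softMax_supportFunction hS hz hd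
  have hb1 : Integrable (fun u : E => L * ‖u‖ + 1) (stdGaussian E) :=
    (IsGaussian.integrable_id.norm.const_mul L).add (integrable_const _)
  have hb2 : ∀ s : ℝ, Integrable (fun u : E => Real.exp (|s| * (L * ‖u‖ + 1))) (stdGaussian E) := by
    intro s
    refine ((integrable_exp_mul_norm_of_isGaussian (stdGaussian E) (|s| * L)).const_mul
      (Real.exp |s|)).congr (ae_of_all _ fun u => ?_)
    simp only
    rw [← Real.exp_add]
    ring_nf
  have hdom : ∀ (s : ℝ) k (u : E), ‖Real.exp (s * softMax z k u)‖ ≤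
      Real.exp (|s| * (L * ‖u‖ + 1)) := by
    intro s k u
    rw [Real.norm_eq_abs, Real.abs_exp]
    refine Real.exp_le_exp.2 ((le_abs_self _).trans ?_)
    rw [abs_mul]
    exact mul_le_mul_of_nonneg_left (abs_softMax_le hzn k u) (abs_nonneg s)
  have hmeas : ∀ (s : ℝ) k, AEStronglyMeasurable (fun u => Real.exp (s * softMax z k u))
      (stdGaussian E) := fun s k =>
    (Real.continuous_exp.comp (continuous_const.mul
      (continuous_softMax z k))).aestronglyMeasurable
  have hlim1 : Filter.Tendsto (fun k => ∫ u, softMax z k u ∂(stdGaussian E)) Filter.atTop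
      (nhds (∫ u, supportFunction S u ∂(stdGaussian E))) :=
    tendsto_integral_of_dominated_convergence _
      (fun k => (continuous_softMax z k).aestronglyMeasurable) hb1
      (fun k => ae_of_all _ (abs_softMax_le hzn k)) (ae_of_all _ hlim)
  have hlim2 : Filter.Tendsto (fun k => ∫ u, Real.exp (s * softMax z k u) ∂(stdGaussian E))
      Filter.atTop (nhds (∫ u, Real.exp (s * supportFunction S u) ∂(stdGaussian E))) :=
    tendsto_integral_of_dominated_convergence _ (hmeas s) (hb2 s)
      (fun k => ae_of_all _ (hdom s k)) (ae_of_all _ fun u =>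
        (Real.continuous_exp.tendsto _).comp ((hlim u).const_mul s))
  refine le_of_tendsto_of_tendsto' hlim2 ((Real.continuous_exp.tendsto _).comp
    ((hlim1.const_mul s).add_const _)) fun k => ?_
  exact integral_exp_le_of_gradient_bound (hasGradientAt_softMax z k)
    (continuous_softMaxGradient z k) (norm_softMaxGradient_le hzn k)
    (hb1.mono' (continuous_softMax z k).aestronglyMeasurable
      (ae_of_all _ (abs_softMax_le hzn k)))
    (fun s => (hb2 s).mono' (hmeas s k) (ae_of_all _ (hdom s k))) s

end SupportFunction

/-! ### Domination by Gaussian vectors in the convex order. -/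

section ConvexComparison

variable {E : Type*} [NormedAddCommGroup E] [InnerProductSpace ℝ E] [FiniteDimensional ℝ E]
  [MeasurableSpace E] [BorelSpace E]

theorem ExpGrowth.integrable_prod {Φ : E → ℝ} (hΦ : ExpGrowth Φ) {ν₁ ν₂ : Measure E}
    [SFinite ν₁] [SFinite ν₂]
    (h₁ : ∀ B : ℝ, Integrable (fun x => Real.exp (B * ‖x‖)) ν₁)
    (h₂ : ∀ B : ℝ, Integrable (fun x => Real.exp (B * ‖x‖)) ν₂) (c₁ c₂ : ℝ) :
    Integrable (fun p : E × E => Φ (c₁ • p.1 + c₂ • p.2)) (ν₁.prod ν₂) := by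
  obtain ⟨A, B, hA, hB, h⟩ := hΦ.exists_bound_nonneg
  refine (((h₁ (B * |c₁|)).mul_prod (h₂ (B * |c₂|))).const_mul A).mono'
    (hΦ.continuous.comp (by fun_prop)).aestronglyMeasurable (ae_of_all _ fun p => ?_)
  refine (h _).trans ?_
  rw [← Real.exp_add]
  gcongr
  have : ‖c₁ • p.1 + c₂ • p.2‖ ≤ |c₁| * ‖p.1‖ + |c₂| * ‖p.2‖ := by
    simpa [norm_smul] using norm_add_le (c₁ • p.1) (c₂ • p.2)
  nlinarith

/-- In polar form, `r₁ • p.1 + r₂ • p.2` is `r` times the first component of a rotated pair, and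
rotation preserves the product law. The polar identities used also hold at `r₁ = r₂ = 0`. -/
theorem integral_stdGaussian_prod {Φ : E → ℝ} (hΦ : Continuous Φ) (r₁ r₂ : ℝ) :
    ∫ p : E × E, Φ (r₁ • p.1 + r₂ • p.2) ∂((stdGaussian E).prod (stdGaussian E)) =
      ∫ g, Φ (√(r₁ ^ 2 + r₂ ^ 2) • g) ∂(stdGaussian E) := by
  have hrot := IsGaussian.map_rotation_eq_self (μ := stdGaussian E) (by simp)
    (Complex.arg ⟨r₁, r₂⟩)
  have h1 := Complex.norm_mul_cos_arg ⟨r₁, r₂⟩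
  have h2 := Complex.norm_mul_sin_arg ⟨r₁, r₂⟩
  rw [Complex.norm_eq_sqrt_sq_add_sq] at h1 h2
  set r := √(r₁ ^ 2 + r₂ ^ 2)
  have h3 : ∫ p : E × E, Φ (r • p.1) ∂((stdGaussian E).prod (stdGaussian E)) =
      ∫ g, Φ (r • g) ∂(stdGaussian E) := by
    simpa using integral_fun_fst (μ := stdGaussian E) (ν := stdGaussian E)
      (f := fun g => Φ (r • g))
  have hcont : Continuous fun p : E × E => Φ (r • p.1) := by fun_prop
  rw [← h3, ← hrot, integral_map (f := fun p : E × E => Φ (r • p.1)) (by fun_prop)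
    hcont.aestronglyMeasurable, hrot]
  congr 1
  ext p
  simp only [ContinuousLinearMap.rotation_apply, smul_add, smul_smul]
  simp only at h1 h2
  rw [h1, h2]

/-- `ν` has all exponential moments and is dominated, in the convex order, by the law of `r • g`
for a standard Gaussian vector `g`. -/
structure ConvexDominated (ν : Measure E) (r : ℝ) : Prop where
  integrable_exp : ∀ B : ℝ, Integrable (fun x => Real.exp (B * ‖x‖)) ν
  integral_le : ∀ Φ : E → ℝ, ConvexOn ℝ Set.univ Φ → ExpGrowth Φ →
    ∫ x, Φ x ∂ν ≤ ∫ g, Φ (r • g) ∂(stdGaussian E)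

/-- The summands are replaced by Gaussians one at a time: with the other summand fixed, a translate
of a convex function is still convex. Fubini exchanges their roles, and the two resulting
independent Gaussians merge into one. -/
theorem ConvexDominated.conv {ν₁ ν₂ : Measure E} [IsProbabilityMeasure ν₁]
    [IsProbabilityMeasure ν₂] {r₁ r₂ : ℝ} (h₁ : ConvexDominated ν₁ r₁)
    (h₂ : ConvexDominated ν₂ r₂) : ConvexDominated (ν₁ ∗ ν₂) √(r₁ ^ 2 + r₂ ^ 2) := by
  have hγ := integrable_exp_mul_norm_of_isGaussian (stdGaussian E)
  have hint : ∀ {Φ : E → ℝ}, ExpGrowth Φ → Integrable Φ (ν₁ ∗ ν₂) := by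
    intro Φ hΦ
    rw [Measure.conv, integrable_map_measure hΦ.continuous.aestronglyMeasurable (by fun_prop)]
    simpa [Function.comp_def] using hΦ.integrable_prod h₁.integrable_exp h₂.integrable_exp 1 1
  refine ⟨fun B => hint (expGrowth_exp_norm B), fun Φ hc hg => ?_⟩
  have i1 := hg.integrable_prod h₁.integrable_exp h₂.integrable_exp 1 1
  have i2 := hg.integrable_prod h₁.integrable_exp hγ 1 r₂
  have i3 := hg.integrable_prod hγ hγ r₁ r₂
  simp only [one_smul] at i1 i2
  rw [integral_conv (hint hg), ← integral_stdGaussian_prod hg.continuous]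
  calc ∫ u, ∫ x, Φ (u + x) ∂ν₂ ∂ν₁
      ≤ ∫ u, ∫ g, Φ (u + r₂ • g) ∂(stdGaussian E) ∂ν₁ := by
        refine integral_mono i1.integral_prod_left i2.integral_prod_left fun u => ?_
        have hc' := convexOn_comp_add_smul hc u 1
        have hg' := hg.comp_add_smul u 1
        simp only [one_smul] at hc' hg'
        exact h₂.integral_le _ hc' hg'
    _ = ∫ g, ∫ u, Φ (u + r₂ • g) ∂ν₁ ∂(stdGaussian E) := integral_integral_swap i2
    _ ≤ ∫ g, ∫ g', Φ (r₁ • g' + r₂ • g) ∂(stdGaussian E) ∂(stdGaussian E) := by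
        refine integral_mono i2.integral_prod_right i3.integral_prod_right fun g => ?_
        have hc' := convexOn_comp_add_smul hc (r₂ • g) 1
        have hg' := hg.comp_add_smul (r₂ • g) 1
        simp only [one_smul, add_comm (r₂ • g)] at hc' hg'
        exact h₁.integral_le _ hc' hg'
    _ = _ := by
        rw [integral_prod_symm _ i3]

variable {Ω : Type*} [MeasurableSpace Ω] {μ : Measure Ω} [IsProbabilityMeasure μ]

theorem convexDominated_dirac_zero : ConvexDominated (Measure.dirac (0 : E)) 0 where
  integrable_exp B := integrable_dirac (by simp)
  integral_le Φ _ _ := by simp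

/-- A random vector agreeing with a standard Gaussian vector up to a random sign is, once
centered, dominated by `2 • g` in the convex order. -/
theorem convexDominated_sub_of_eq_or_eq_neg {X a : Ω → E} (hX : Measurable X)
    (ha : HasLaw a (stdGaussian E) μ) (hXa : ∀ᵐ ω ∂μ, X ω = a ω ∨ X ω = -a ω) :
    ConvexDominated (μ.map fun ω => X ω - ∫ ω', X ω' ∂μ) 2 := by
  set b := ∫ ω', X ω' ∂μ with hb
  have ham : AEMeasurable a μ := ha.aemeasurable
  have hexpa : ∀ {Φ : E → ℝ}, ExpGrowth Φ → Integrable (fun ω => Φ (a ω)) μ := by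
    intro Φ hΦ
    have := hΦ.integrable (integrable_exp_mul_norm_of_isGaussian (stdGaussian E))
    rw [← ha.map_eq] at this
    exact this.comp_aemeasurable ham
  have hnorm : ∀ᵐ ω ∂μ, ‖X ω‖ = ‖a ω‖ := by
    filter_upwards [hXa] with ω h
    rcases h with h | h <;> simp [h]
  have hmom : ∀ B : ℝ, Integrable (fun x => Real.exp (B * ‖x‖)) (μ.map X) := by
    intro B
    rw [integrable_map_measure (by fun_prop) hX.aemeasurable]
    refine (hexpa (expGrowth_exp_norm B)).congr ?_
    filter_upwards [hnorm] with ω h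
    simp [h]
  have hexpX : ∀ {Φ : E → ℝ}, ExpGrowth Φ → Integrable (fun ω => Φ (X ω)) μ := by
    intro Φ hΦ
    exact (hΦ.integrable hmom).comp_measurable hX
  have hXi : Integrable X μ := by
    refine (hexpX (expGrowth_exp_norm 1)).mono' hX.aestronglyMeasurable (ae_of_all _ fun ω => ?_)
    simp only [one_mul]
    linarith [Real.add_one_le_exp ‖X ω‖]
  have hXb : Measurable fun ω => X ω - b := hX.sub_const b
  refine ⟨fun B => ?_, fun Φ hc hg => ?_⟩
  · rw [integrable_map_measure (by fun_prop) hXb.aemeasurable]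
    refine (hexpX ((expGrowth_exp_norm B).comp_add_smul (-b) 1)).congr (ae_of_all _ fun ω => ?_)
    simp [neg_add_eq_sub]
  · rw [integral_map hXb.aemeasurable hg.continuous.aestronglyMeasurable]
    have g2 := hg.comp_add_smul 0 2
    have gm2 := hg.comp_add_smul 0 (-2)
    have gb := hg.comp_add_smul (-b) 1
    simp only [zero_add, one_smul, neg_add_eq_sub] at g2 gm2 gb
    have hjen : Φ ((-2 : ℝ) • b) ≤ ∫ ω, Φ ((-2 : ℝ) • X ω) ∂μ := by
      rw [hb, ← integral_smul]
      exact hc.map_integral_le hg.continuous.continuousOn isClosed_univ (by simp)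
        (hXi.smul (-2 : ℝ)) (hexpX gm2)
    -- `X - b` is the midpoint of `2 • X` and `-2 • b`, and the second term is handled by Jensen's
    -- inequality above.
    have hpt : ∀ ω, Φ (X ω - b) ≤ (1 / 2) * Φ ((2 : ℝ) • X ω) + (1 / 2) * Φ ((-2 : ℝ) • b) := by
      intro ω
      have h := hc.2 (Set.mem_univ ((2 : ℝ) • X ω)) (Set.mem_univ ((-2 : ℝ) • b))
        one_half_pos.le one_half_pos.le (add_halves (1 : ℝ))
      refine le_of_eq_of_le (congrArg Φ ?_) h
      module
    have hsym : ∫ g, Φ ((-2 : ℝ) • g) ∂(stdGaussian E) = ∫ g, Φ ((2 : ℝ) • g) ∂(stdGaussian E) := by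
      have h := stdGaussian_map (LinearIsometryEquiv.neg ℝ (E := E))
      conv_rhs => rw [← h]
      rw [integral_map (by fun_prop) g2.continuous.aestronglyMeasurable]
      simp
    have hlaw : ∀ {Ψ : E → ℝ}, Continuous Ψ →
        ∫ ω, Ψ (a ω) ∂μ = ∫ g, Ψ g ∂(stdGaussian E) := by
      intro Ψ hΨ
      rw [← ha.map_eq, integral_map ham hΨ.aestronglyMeasurable]
    -- The sum of `Φ` at `2 • X` and at `-2 • X` does not see the sign relating `X` to `a`. No
    -- independence between the sign and `a` is therefore needed.
    have hsum : ∫ ω, Φ ((2 : ℝ) • X ω) ∂μ + ∫ ω, Φ ((-2 : ℝ) • X ω) ∂μ =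
        2 * ∫ g, Φ ((2 : ℝ) • g) ∂(stdGaussian E) := by
      rw [← integral_add (hexpX g2) (hexpX gm2), two_mul]
      conv_rhs => arg 2; rw [← hsym]
      rw [← hlaw g2.continuous, ← hlaw gm2.continuous, ← integral_add (hexpa g2) (hexpa gm2)]
      refine integral_congr_ae ?_
      filter_upwards [hXa] with ω h
      rcases h with h | h
      · simp [h]
      · simp [h, add_comm]
    calc ∫ ω, Φ (X ω - b) ∂μ
        ≤ ∫ ω, ((1 / 2) * Φ ((2 : ℝ) • X ω) + (1 / 2) * Φ ((-2 : ℝ) • b)) ∂μ :=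
          integral_mono (hexpX gb) (((hexpX g2).const_mul _).add (integrable_const _)) hpt
      _ = (1 / 2) * ∫ ω, Φ ((2 : ℝ) • X ω) ∂μ + (1 / 2) * Φ ((-2 : ℝ) • b) := by
          rw [integral_add ((hexpX g2).const_mul _) (integrable_const _), integral_const_mul]
          simp
      _ ≤ _ := by linarith

/-- Comparison of a sum of independent centered vectors with a Gaussian vector. -/
theorem convexDominated_sum {ι : Type*} {X a : ι → Ω → E} (hX : ∀ i, Measurable (X i))
    (hind : iIndepFun X μ) (ha : ∀ i, HasLaw (a i) (stdGaussian E) μ)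
    (hXa : ∀ i, ∀ᵐ ω ∂μ, X i ω = a i ω ∨ X i ω = -a i ω) (s : Finset ι) :
    ConvexDominated (μ.map fun ω => ∑ i ∈ s, (X i ω - ∫ ω', X i ω' ∂μ)) (2 * √(s.card)) := by
  classical
  set Y : ι → Ω → E := fun i ω => X i ω - ∫ ω', X i ω' ∂μ with hY
  have hYm : ∀ i, Measurable (Y i) := fun i => (hX i).sub_const _
  have hYind : iIndepFun Y μ := hind.comp (fun i x => x - ∫ ω', X i ω' ∂μ)
    fun i => measurable_id.sub_const _
  have hfun : ∀ t : Finset ι, (fun ω => ∑ i ∈ t, Y i ω) = ∑ i ∈ t, Y i := fun t => by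
    ext1 ω; simp
  change ConvexDominated (μ.map fun ω => ∑ i ∈ s, Y i ω) _
  rw [hfun]
  induction s using Finset.induction_on with
  | empty =>
    have : μ.map (0 : Ω → E) = Measure.dirac 0 := by
      change μ.map (fun _ => (0 : E)) = _
      rw [Measure.map_const]; simp
    simpa [this] using convexDominated_dirac_zero (E := E)
  | insert j s hj ih =>
    have hsm : Measurable (∑ i ∈ s, Y i) := by
      rw [← hfun]
      exact Finset.measurable_sum s fun i _ => hYm i
    have hi := hYind.indepFun_finsetSum_of_notMem hYm hj
    have : IsProbabilityMeasure (μ.map (∑ i ∈ s, Y i)) :=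
      Measure.isProbabilityMeasure_map hsm.aemeasurable
    have : IsProbabilityMeasure (μ.map (Y j)) :=
      Measure.isProbabilityMeasure_map (hYm j).aemeasurable
    rw [Finset.sum_insert hj, add_comm, hi.map_add_eq_map_conv_map hsm (hYm j),
      Finset.card_insert_of_notMem hj]
    have h := ih.conv (convexDominated_sub_of_eq_or_eq_neg (hX j) (ha j) (hXa j))
    have e : √((2 * √(s.card : ℝ)) ^ 2 + 2 ^ 2) = 2 * √((s.card + 1 : ℕ) : ℝ) := by
      rw [mul_pow, Real.sq_sqrt (by positivity), Real.sqrt_eq_iff_mul_self_eq (by positivity)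
        (by positivity), ← pow_two, mul_pow, Real.sq_sqrt (by positivity)]
      push_cast; ring
    rwa [e] at h

end ConvexComparison

/-! ### Mean and independence in the one-bit model. -/

section Model

/-- The Bochner integral of a non-integrable function is zero by convention, so positivity of the
correlation already encodes integrability. -/
theorem integrable_of_correlation_pos {θ : ℝ → ℝ} (h : 0 < correlation θ) :
    Integrable (fun z => θ z * z) (gaussianReal 0 1) := by
  by_contra hn
  rw [correlation, integral_undef hn] at h
  exact lt_irrefl _ h

/-- Dividing `θ z * z` by `z` recovers `θ` away from the null set `{0}`. -/
theorem aemeasurable_of_correlation_pos {θ : ℝ → ℝ} (h : 0 < correlation θ) :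
    AEMeasurable θ (gaussianReal 0 1) := by
  have hi := (integrable_of_correlation_pos h).aestronglyMeasurable.aemeasurable
  refine (hi.div aemeasurable_id).congr ?_
  have : NullSingletonClass (gaussianReal 0 1) := nullSingletonClass_gaussianReal one_ne_zero
  filter_upwards [compl_mem_ae_iff.2 (measure_singleton (μ := gaussianReal 0 1) (0 : ℝ))] with z hz
  have : z ≠ 0 := hz
  simp [this]

section Gaussian

variable {E : Type*} [NormedAddCommGroup E] [InnerProductSpace ℝ E] [FiniteDimensional ℝ E]
  [MeasurableSpace E] [BorelSpace E]

theorem map_inner_stdGaussian_of_norm_eq_one {x : E} (hx : ‖x‖ = 1) :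
    (stdGaussian E).map (fun g => inner ℝ g x) = gaussianReal 0 1 := by
  have h := map_inner_stdGaussian x
  have e : ‖x‖₊ = 1 := by ext; simpa using hx
  simp only [e, one_pow] at h
  simpa only [real_inner_comm] using h

/-- Reflection in the line `ℝ ∙ x` preserves the Gaussian law and `⟨g, x⟩`, while reversing the
component of `g` orthogonal to `x`. Only the component of `z` along `x` survives. -/
theorem integral_comp_inner_mul_inner {θ : ℝ → ℝ} {x : E} (hx : ‖x‖ = 1)
    (hθ : 0 < correlation θ) (z : E)
    (hz : Integrable (fun g => θ (inner ℝ g x) * inner ℝ g z) (stdGaussian E)) :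
    ∫ g, θ (inner ℝ g x) * inner ℝ g z ∂(stdGaussian E) = correlation θ * inner ℝ x z := by
  have hmap := map_inner_stdGaussian_of_norm_eq_one hx
  have hm : AEMeasurable (fun g => inner ℝ g x) (stdGaussian E) := by fun_prop
  have hi := integrable_of_correlation_pos hθ
  have hxi : Integrable (fun g => θ (inner ℝ g x) * inner ℝ g x) (stdGaussian E) := by
    rw [← hmap] at hi
    exact hi.comp_aemeasurable hm
  have hxv : ∫ g, θ (inner ℝ g x) * inner ℝ g x ∂(stdGaussian E) = correlation θ := by
    rw [correlation, ← hmap, integral_map hm (by rw [hmap]; exact hi.aestronglyMeasurable)]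
  have hR : ∀ g z, inner ℝ ((ℝ ∙ x).reflection g) z =
      2 * inner ℝ x z * inner ℝ g x - inner ℝ g z := by
    intro g z
    rw [Submodule.reflection_singleton_apply, inner_sub_left, hx]
    simp only [two_smul, inner_add_left, real_inner_smul_left, real_inner_comm x g]
    simp
    ring
  have hrefl : ∫ g, θ (inner ℝ g x) * inner ℝ g z ∂(stdGaussian E) =
      ∫ g, (2 * inner ℝ x z * (θ (inner ℝ g x) * inner ℝ g x) - θ (inner ℝ g x) * inner ℝ g z)
        ∂(stdGaussian E) := by
    have h := stdGaussian_map ((ℝ ∙ x).reflection)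
    have hme : MeasurableEmbedding ((ℝ ∙ x).reflection) :=
      ((ℝ ∙ x).reflection).toHomeomorph.measurableEmbedding
    conv_lhs => rw [← h, hme.integral_map]
    congr 1
    ext g
    rw [hR, hR, real_inner_self_eq_norm_sq, hx]
    ring_nf
  rw [integral_sub (hxi.const_mul _) hz, integral_const_mul, hxv] at hrefl
  linarith

end Gaussian

variable {Ω : Type*} {n m : ℕ} {a : Fin m → Ω → EuclideanSpace ℝ (Fin n)}

theorem measurable_sigmaOf (i : Fin m) : Measurable[sigmaOf a] (a i) :=
  (measurable_pi_apply i).comp (comap_measurable fun ω i => a i ω)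

variable [MeasurableSpace Ω] {μ : Measure Ω} {y : Fin m → Ω → ℝ} {θ : ℝ → ℝ}
  {x : EuclideanSpace ℝ (Fin n)}

theorem sigmaOf_le (ha : ∀ i, Measurable (a i)) : sigmaOf a ≤ ‹MeasurableSpace Ω› :=
  (measurable_pi_lambda _ ha).comap_le

theorem OneBitModel.eq_or_eq_neg (H : OneBitModel μ a y θ x) (i : Fin m) :
    ∀ᵐ ω ∂μ, y i ω • a i ω = a i ω ∨ y i ω • a i ω = -a i ω := by
  filter_upwards [H.sign_valued i] with ω h
  rcases h with h | h <;> simp [h]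

theorem OneBitModel.measurable_smul (H : OneBitModel μ a y θ x) (i : Fin m) :
    Measurable fun ω => y i ω • a i ω := (H.measurable_y i).smul (H.measurable_a i)

variable [IsProbabilityMeasure μ]

theorem OneBitModel.integrable_y (H : OneBitModel μ a y θ x) (i : Fin m) : Integrable (y i) μ := by
  refine (integrable_const (1 : ℝ)).mono' (H.measurable_y i).aestronglyMeasurable ?_
  filter_upwards [H.sign_valued i] with ω h
  rcases h with h | h <;> simp [h]

/-- Conditionally on all the measurement vectors, the law of `y i` depends on `a i` alone: a
two-valued variable is determined in law by its mean. This is what lets the joint probabilities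
factor. -/
theorem OneBitModel.exists_condProb (H : OneBitModel μ a y θ x) (hx : ‖x‖ = 1)
    (hθ : 0 < correlation θ) (i : Fin m) (B : Set ℝ) :
    ∃ q : EuclideanSpace ℝ (Fin n) → ℝ, Measurable q ∧
      μ[(y i ⁻¹' B).indicator (fun _ => (1 : ℝ)) | sigmaOf a] =ᵐ[μ] fun ω => q (a i ω) := by
  classical
  have hmap := map_inner_stdGaussian_of_norm_eq_one hx
  -- On `{-1, 1}` the indicator of `B` agrees with the affine function `t ↦ α + β * t`.
  set α : ℝ := (B.indicator 1 1 + B.indicator 1 (-1)) / 2 with hα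
  set β : ℝ := (B.indicator 1 1 - B.indicator 1 (-1)) / 2 with hβ
  obtain ⟨θ', hθ', hθe⟩ := aemeasurable_of_correlation_pos hθ
  have h1 : (y i ⁻¹' B).indicator (fun _ => (1 : ℝ)) =ᵐ[μ] (fun _ => α) + β • y i := by
    filter_upwards [H.sign_valued i] with ω h
    simp only [Pi.add_apply, Pi.smul_apply, smul_eq_mul, Set.indicator, Set.mem_preimage, hα, hβ,
      Pi.one_apply]
    rcases h with h | h <;> rw [h] <;> ring
  have h2 : (fun ω => θ (inner ℝ (a i ω) x)) =ᵐ[μ] fun ω => θ' (inner ℝ (a i ω) x) := by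
    have e1 : ∀ᵐ g ∂(stdGaussian (EuclideanSpace ℝ (Fin n))),
        θ (inner ℝ g x) = θ' (inner ℝ g x) := by
      rw [← hmap] at hθe
      exact ae_of_ae_map (by fun_prop) hθe
    rw [← (H.gaussian i).map_eq] at e1
    exact ae_of_ae_map (H.measurable_a i).aemeasurable e1
  refine ⟨fun v => α + β * θ' (inner ℝ v x), by fun_prop, ?_⟩
  have h3 := condExp_add (m := sigmaOf a) (integrable_const (μ := μ) α)
    ((H.integrable_y i).smul β)
  have h4 := condExp_smul (μ := μ) β (y i) (sigmaOf a)
  rw [condExp_const (sigmaOf_le H.measurable_a)] at h3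
  filter_upwards [condExp_congr_ae (m := sigmaOf a) h1, h2, h3, h4, H.condMean i]
    with ω e1 e2 e3 e4 e5
  rw [e1, e3, Pi.add_apply, e4, Pi.smul_apply, e5, e2, smul_eq_mul]

/-- Probability of a rectangle event for the pairs `(a i, y i)`. -/
theorem OneBitModel.measureReal_iInter_inter (H : OneBitModel μ a y θ x)
    {A : Fin m → Set (EuclideanSpace ℝ (Fin n))} {B : Fin m → Set ℝ}
    (hA : ∀ i, MeasurableSet (A i)) (hB : ∀ i, MeasurableSet (B i))
    {q : Fin m → EuclideanSpace ℝ (Fin n) → ℝ} (hq : ∀ i, Measurable (q i))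
    (hqe : ∀ i, μ[(y i ⁻¹' B i).indicator (fun _ => (1 : ℝ)) | sigmaOf a] =ᵐ[μ]
      fun ω => q i (a i ω)) (S : Finset (Fin m)) :
    μ.real (⋂ i ∈ S, (a i ⁻¹' A i ∩ y i ⁻¹' B i)) =
      ∏ i ∈ S, ∫ ω, (A i).indicator (q i) (a i ω) ∂μ := by
  classical
  have hle := sigmaOf_le H.measurable_a
  set U : Set Ω := ⋂ i ∈ S, a i ⁻¹' A i with hU
  set V : Set Ω := ⋂ i ∈ S, y i ⁻¹' B i with hV
  have hUm : MeasurableSet[sigmaOf a] U :=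
    Finset.measurableSet_biInter (m := sigmaOf a) S fun i _ => measurable_sigmaOf i (hA i)
  have hVm : MeasurableSet V := Finset.measurableSet_biInter S fun i _ => H.measurable_y i (hB i)
  have hUV : (⋂ i ∈ S, (a i ⁻¹' A i ∩ y i ⁻¹' B i)) = V ∩ U := by
    ext ω
    simp only [hU, hV, Set.mem_iInter, Set.mem_inter_iff]
    exact ⟨fun h => ⟨fun i hi => (h i hi).2, fun i hi => (h i hi).1⟩,
      fun h i hi => ⟨h.2 i hi, h.1 i hi⟩⟩
  have hVi : Integrable (V.indicator fun _ => (1 : ℝ)) μ := (integrable_const _).indicator hVm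
  have hprod : ∀ᵐ ω ∂μ, (μ[V.indicator (fun _ => (1 : ℝ)) | sigmaOf a]) ω =
      ∏ i ∈ S, q i (a i ω) := by
    have hall := ae_all_iff.2 hqe
    filter_upwards [H.condIndep S B fun i _ => hB i, hall] with ω h1 h2
    rw [h1]
    exact Finset.prod_congr rfl fun i _ => h2 i
  calc μ.real (⋂ i ∈ S, (a i ⁻¹' A i ∩ y i ⁻¹' B i))
      = ∫ ω in U, V.indicator (fun _ => (1 : ℝ)) ω ∂μ := by
        rw [hUV, integral_indicator_const _ hVm, measureReal_restrict_apply hVm]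
        simp
    _ = ∫ ω in U, (μ[V.indicator (fun _ => (1 : ℝ)) | sigmaOf a]) ω ∂μ :=
        (setIntegral_condExp hle hVi hUm).symm
    _ = ∫ ω in U, ∏ i ∈ S, q i (a i ω) ∂μ := integral_congr_ae (ae_restrict_of_ae hprod)
    -- Padding with the factor 1 outside `S` allows the independence of the whole family `a` to be
    -- used at once.
    _ = ∫ ω, ∏ i, (if i ∈ S then (A i).indicator (q i) else 1) (a i ω) ∂μ := by
        rw [← integral_indicator (hle _ hUm)]
        congr 1
        ext ω
        have e : ∏ i, (if i ∈ S then (A i).indicator (q i) else 1) (a i ω) =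
            ∏ i ∈ S, (A i).indicator (q i) (a i ω) := by
          rw [← Finset.prod_ite_mem_eq S]
          refine Finset.prod_congr rfl fun i _ => ?_
          split_ifs <;> rfl
        rw [e]
        by_cases hω : ω ∈ U
        · rw [Set.indicator_of_mem hω]
          refine Finset.prod_congr rfl fun i hi => ?_
          have : a i ω ∈ A i := by
            have := Set.mem_iInter₂.1 hω i hi
            exact this
          rw [Set.indicator_of_mem this]
        · rw [Set.indicator_of_notMem hω]
          simp only [hU, Set.mem_iInter, not_forall] at hω
          obtain ⟨i, hi, hi'⟩ := hω
          exact (Finset.prod_eq_zero hi (Set.indicator_of_notMem (s := A i) hi' (q i))).symm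
    _ = ∏ i, ∫ ω, (if i ∈ S then (A i).indicator (q i) else 1) (a i ω) ∂μ := by
        refine H.indep.integral_fun_prod_comp (fun i => (H.measurable_a i).aemeasurable) fun i => ?_
        split_ifs
        · exact ((hq i).indicator (hA i)).aestronglyMeasurable
        · exact aestronglyMeasurable_const
    _ = _ := by
        rw [← Finset.prod_ite_mem_eq S]
        refine Finset.prod_congr rfl fun i _ => ?_
        split_ifs <;> simp

/-- Rectangle events form a generating π-system for each pair. Their joint probabilities factor by
conditional independence of the `y i` followed by independence of the `a i`. -/
theorem OneBitModel.iIndepFun_prodMk (H : OneBitModel μ a y θ x) (hx : ‖x‖ = 1)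
    (hθ : 0 < correlation θ) : iIndepFun (fun i ω => (a i ω, y i ω)) μ := by
  rw [iIndepFun_iff_iIndep]
  set π : Fin m → Set (Set Ω) := fun i => {U | ∃ A : Set (EuclideanSpace ℝ (Fin n)),
    MeasurableSet A ∧ ∃ B : Set ℝ, MeasurableSet B ∧ U = a i ⁻¹' A ∩ y i ⁻¹' B} with hπ
  have hpair : ∀ i, Measurable fun ω => (a i ω, y i ω) := fun i =>
    (H.measurable_a i).prodMk (H.measurable_y i)
  have hπ' : ∀ i, π i = {s | ∃ t ∈ Set.image2 (· ×ˢ ·) {A | MeasurableSet A} {B | MeasurableSet B},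
      (fun ω => (a i ω, y i ω)) ⁻¹' t = s} := by
    intro i
    ext U
    constructor
    · rintro ⟨A, hA, B, hB, rfl⟩
      exact ⟨A ×ˢ B, ⟨A, hA, B, hB, rfl⟩, rfl⟩
    · rintro ⟨_, ⟨A, hA, B, hB, rfl⟩, rfl⟩
      exact ⟨A, hA, B, hB, rfl⟩
  refine iIndepSets.iIndep (fun i => (hpair i).comap_le) π (fun i => ?_) (fun i => ?_) ?_
  · rw [hπ']
    exact isPiSystem_prod.comap _
  · rw [hπ', ← generateFrom_prod, MeasurableSpace.comap_generateFrom]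
    rfl
  · rw [iIndepSets_iff]
    intro S f hf
    have hex : ∀ i, ∃ A : Set (EuclideanSpace ℝ (Fin n)), MeasurableSet A ∧ ∃ B : Set ℝ,
        MeasurableSet B ∧ (i ∈ S → f i = a i ⁻¹' A ∩ y i ⁻¹' B) := by
      intro i
      by_cases hi : i ∈ S
      · obtain ⟨A, hA, B, hB, h⟩ := hf i hi
        exact ⟨A, hA, B, hB, fun _ => h⟩
      · exact ⟨∅, MeasurableSet.empty, ∅, MeasurableSet.empty, fun h => absurd h hi⟩
    choose A hA B hB hfe using hex
    choose q hq hqe using fun i => H.exists_condProb hx hθ i (B i)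
    have key := H.measureReal_iInter_inter hA hB hq hqe
    have hsing : ∀ i ∈ S, μ.real (f i) = ∫ ω, (A i).indicator (q i) (a i ω) ∂μ := by
      intro i hi
      have h := key {i}
      simp only [Finset.mem_singleton, Set.iInter_iInter_eq_left, Finset.prod_singleton] at h
      rw [hfe i hi, h]
    have hS : (⋂ i ∈ S, f i) = ⋂ i ∈ S, (a i ⁻¹' A i ∩ y i ⁻¹' B i) :=
      Set.iInter₂_congr hfe
    have hreal : μ.real (⋂ i ∈ S, f i) = ∏ i ∈ S, μ.real (f i) := by
      rw [hS, key S]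
      exact Finset.prod_congr rfl fun i hi => (hsing i hi).symm
    rw [← ENNReal.toReal_eq_toReal_iff' (measure_ne_top _ _)
      (ENNReal.prod_ne_top fun i _ => measure_ne_top _ _), ENNReal.toReal_prod]
    exact hreal

theorem OneBitModel.iIndepFun_smul (H : OneBitModel μ a y θ x) (hx : ‖x‖ = 1)
    (hθ : 0 < correlation θ) : iIndepFun (fun i ω => y i ω • a i ω) μ :=
  (H.iIndepFun_prodMk hx hθ).comp (fun _ p => p.2 • p.1)
    fun _ => measurable_snd.smul measurable_fst

/-- Tested against `z`, the tower property replaces `y i` by `θ ⟨a i, x⟩`, and the reflection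
identity evaluates the resulting Gaussian integral. -/
theorem OneBitModel.integral_smul (H : OneBitModel μ a y θ x) (hx : ‖x‖ = 1)
    (hθ : 0 < correlation θ) (i : Fin m) :
    ∫ ω, y i ω • a i ω ∂μ = correlation θ • x := by
  have hle := sigmaOf_le H.measurable_a
  have ham := (H.measurable_a i).aemeasurable (μ := μ)
  have hai : Integrable (a i) μ := by
    have h := IsGaussian.integrable_id (μ := stdGaussian (EuclideanSpace ℝ (Fin n)))
    rw [← (H.gaussian i).map_eq] at h
    exact h.comp_aemeasurable ham
  have hyi : Integrable (fun ω => y i ω • a i ω) μ := by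
    refine hai.norm.mono' (H.measurable_smul i).aestronglyMeasurable ?_
    filter_upwards [H.eq_or_eq_neg i] with ω h
    rcases h with h | h <;> simp [h]
  refine ext_inner_left ℝ fun z => ?_
  rw [← integral_inner hyi]
  have hin : ∀ ω, inner ℝ z (y i ω • a i ω) = ((fun ω => inner ℝ (a i ω) z) * y i) ω := by
    intro ω
    rw [real_inner_smul_right, real_inner_comm, Pi.mul_apply, mul_comm]
  have hprod : Integrable ((fun ω => inner ℝ (a i ω) z) * y i) μ :=
    (hyi.const_inner z).congr (ae_of_all _ hin)
  have hsm : StronglyMeasurable[sigmaOf a] fun ω => inner ℝ (a i ω) z :=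
    ((by fun_prop : Measurable fun v : EuclideanSpace ℝ (Fin n) => inner ℝ v z).comp
      (measurable_sigmaOf i)).stronglyMeasurable
  have hce : μ[(fun ω => inner ℝ (a i ω) z) * y i | sigmaOf a] =ᵐ[μ]
      fun ω => θ (inner ℝ (a i ω) x) * inner ℝ (a i ω) z := by
    filter_upwards [condExp_mul_of_stronglyMeasurable_left hsm hprod (H.integrable_y i),
      H.condMean i] with ω h1 h2
    rw [h1, Pi.mul_apply, h2, mul_comm]
  have hθm : AEStronglyMeasurable (fun g => θ (inner ℝ g x) * inner ℝ g z)
      (stdGaussian (EuclideanSpace ℝ (Fin n))) := by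
    have h := aemeasurable_of_correlation_pos hθ
    rw [← map_inner_stdGaussian_of_norm_eq_one hx] at h
    exact ((h.comp_aemeasurable (by fun_prop)).mul (by fun_prop)).aestronglyMeasurable
  -- Integrability is inherited from the conditional expectation, so no pointwise bound on `θ` is
  -- required.
  have hint : Integrable (fun g => θ (inner ℝ g x) * inner ℝ g z)
      (stdGaussian (EuclideanSpace ℝ (Fin n))) := by
    rw [← (H.gaussian i).map_eq] at hθm ⊢
    rw [integrable_map_measure hθm ham]
    exact integrable_condExp.congr hce
  calc ∫ ω, inner ℝ z (y i ω • a i ω) ∂μ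
      = ∫ ω, ((fun ω => inner ℝ (a i ω) z) * y i) ω ∂μ := integral_congr_ae (ae_of_all _ hin)
    _ = ∫ ω, (μ[(fun ω => inner ℝ (a i ω) z) * y i | sigmaOf a]) ω ∂μ :=
        (integral_condExp hle).symm
    _ = ∫ ω, θ (inner ℝ (a i ω) x) * inner ℝ (a i ω) z ∂μ := integral_congr_ae hce
    _ = ∫ g, θ (inner ℝ g x) * inner ℝ g z ∂(stdGaussian (EuclideanSpace ℝ (Fin n))) :=
        (H.gaussian i).integral_comp hθm
    _ = correlation θ * inner ℝ x z := integral_comp_inner_mul_inner hx hθ z hint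
    _ = inner ℝ z (correlation θ • x) := by rw [real_inner_smul_right, real_inner_comm]

end Model

/-! ### From uniform deviation to recovery. -/

section Recovery

variable {n m : ℕ} {K : Set (EuclideanSpace ℝ (Fin n))}

theorem sub_self_subset_closedBall (hK : K ⊆ Metric.closedBall 0 1) :
    K - K ⊆ Metric.closedBall 0 2 := by
  rintro _ ⟨u, hu, v, hv, rfl⟩
  have hu := hK hu
  have hv := hK hv
  rw [mem_closedBall_zero_iff] at *
  linarith [norm_sub_le u v]

theorem meanWidth_nonneg (hK : K ⊆ Metric.closedBall 0 1) (hne : K.Nonempty) :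
    0 ≤ meanWidth K := by
  obtain ⟨x, hx⟩ := hne
  refine integral_nonneg fun g => ?_
  have h := inner_le_supportFunction (sub_self_subset_closedBall hK) g (Set.sub_mem_sub hx hx)
  rw [sub_self, inner_zero_right] at h
  exact h

/-- Deterministic part: a uniform deviation bound on `K - K` controls the error of solutions. -/
theorem IsSolution.norm_sub_sq_le {x xhat : EuclideanSpace ℝ (Fin n)} {b : Fin m → ℝ}
    {v : Fin m → EuclideanSpace ℝ (Fin n)} {l δ : ℝ} (hm : 0 < m) (hl : 0 < l)
    (hK : K ⊆ Metric.closedBall 0 1) (hxK : x ∈ K) (hx : ‖x‖ = 1)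
    (hdev : supportFunction (K - K) (∑ i, (b i • v i - l • x)) ≤ m * δ / 2)
    (h : IsSolution K v b xhat) : ‖xhat - x‖ ^ 2 ≤ δ / l := by
  have hm' : (0 : ℝ) < m := Nat.cast_pos.2 hm
  have hball := sub_self_subset_closedBall hK
  have h1 := (inner_le_supportFunction hball (∑ i, (b i • v i - l • x))
    (Set.sub_mem_sub h.1 hxK)).trans hdev
  have h2 := h.2 x hxK
  -- By optimality the difference of the two objective values is nonnegative, so the deviation at
  -- `xhat - x` is at least `m * l * (1 - ⟨x, xhat⟩)`.
  have h3 : inner ℝ (∑ i, (b i • v i - l • x)) (xhat - x) =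
      ∑ i, b i * inner ℝ (v i) xhat - ∑ i, b i * inner ℝ (v i) x -
        m * l * (inner ℝ x xhat - 1) := by
    rw [sum_inner]
    simp only [inner_sub_left, inner_sub_right, real_inner_smul_left, Finset.sum_sub_distrib,
      Finset.sum_const, Finset.card_univ, Fintype.card_fin, nsmul_eq_mul,
      real_inner_self_eq_norm_sq, hx]
    ring
  have h4 : ‖xhat‖ ≤ 1 := by simpa using hK h.1
  have h5 : ‖xhat - x‖ ^ 2 ≤ 2 * (1 - inner ℝ x xhat) := by
    rw [norm_sub_sq_real, hx, real_inner_comm]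
    nlinarith [norm_nonneg xhat]
  have h6 : m * l * (1 - inner ℝ x xhat) ≤ m * δ / 2 := by linarith
  rw [le_div_iff₀ hl]
  have h7 : l * (1 - inner ℝ x xhat) ≤ δ / 2 := by
    have : m * (l * (1 - inner ℝ x xhat)) ≤ m * (δ / 2) := by linarith
    exact le_of_mul_le_mul_left this hm'
  nlinarith

variable {Ω : Type*} [MeasurableSpace Ω] {μ : Measure Ω} [IsProbabilityMeasure μ]
  {a : Fin m → Ω → EuclideanSpace ℝ (Fin n)} {y : Fin m → Ω → ℝ} {θ : ℝ → ℝ}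
  {x : EuclideanSpace ℝ (Fin n)}

/-- Tail bound for the uniform deviation of the empirical objective. -/
theorem OneBitModel.measureReal_deviation_ge_le (H : OneBitModel μ a y θ x)
    (hK : K ⊆ Metric.closedBall 0 1) (hne : K.Nonempty) (hx : ‖x‖ = 1)
    (hθ : 0 < correlation θ) {s : ℝ} (hs : 0 ≤ s) (ε : ℝ) :
    μ.real {ω | ε ≤ supportFunction (K - K)
        (∑ i, (y i ω • a i ω - correlation θ • x))} ≤
      Real.exp (-s * ε + 2 * s * √m * meanWidth K + 2 * s ^ 2 * Real.pi ^ 2 * m) := by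
  have hball := sub_self_subset_closedBall hK
  have hne' : (K - K).Nonempty := hne.sub hne
  set W : Ω → EuclideanSpace ℝ (Fin n) := fun ω =>
    ∑ i, (y i ω • a i ω - correlation θ • x) with hW
  set h := supportFunction (K - K) with hh
  have hWm : Measurable W := Finset.measurable_sum _ fun i _ => (H.measurable_smul i).sub_const _
  have hdom : ConvexDominated (μ.map W) (2 * √m) := by
    have := convexDominated_sum H.measurable_smul (H.iIndepFun_smul hx hθ) H.gaussian
      H.eq_or_eq_neg Finset.univ
    simpa only [H.integral_smul hx hθ, Finset.card_univ, Fintype.card_fin] using this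
  have hgrow : ExpGrowth fun u => Real.exp (s * h u) := by
    refine ⟨Real.continuous_exp.comp (continuous_const.mul (continuous_supportFunction hne' hball)),
      1, s * 2, fun u => ?_⟩
    rw [Real.abs_exp, one_mul, mul_assoc]
    exact Real.exp_le_exp.2 (mul_le_mul_of_nonneg_left
      (abs_le.1 (abs_supportFunction_le hne' hball u)).2 hs)
  have hconv : ConvexOn ℝ Set.univ fun u => Real.exp (s * h u) := by
    have h1 := (convexOn_supportFunction hne' hball).smul hs
    refine ⟨convex_univ, fun u _ v _ p q hp hq hpq => ?_⟩
    exact (Real.exp_le_exp.2 (h1.2 (Set.mem_univ u) (Set.mem_univ v) hp hq hpq)).trans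
      (convexOn_exp.2 (Set.mem_univ _) (Set.mem_univ _) hp hq hpq)
  have hint : Integrable (fun ω => Real.exp (s * h (W ω))) μ :=
    (hgrow.integrable hdom.integrable_exp).comp_measurable hWm
  have hmgf : mgf (fun ω => h (W ω)) μ s ≤
      Real.exp (2 * s * √m * meanWidth K + 2 * s ^ 2 * Real.pi ^ 2 * m) := by
    calc mgf (fun ω => h (W ω)) μ s = ∫ u, Real.exp (s * h u) ∂(μ.map W) :=
          (integral_map hWm.aemeasurable hgrow.continuous.aestronglyMeasurable).symm
      _ ≤ ∫ g, Real.exp (s * h ((2 * √m) • g)) ∂(stdGaussian _) := hdom.integral_le _ hconv hgrow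
      _ = ∫ g, Real.exp (2 * s * √m * h g) ∂(stdGaussian _) := by
          congr 1
          ext g
          rw [hh, supportFunction_smul (by positivity)]
          ring_nf
      -- The moment bound is used at parameter `2 * s * √m` with radius `L = 2`.
      _ ≤ _ := by
          refine (integral_exp_supportFunction_le hne' hball _).trans (le_of_eq ?_)
          have e : (2 * s * √(m : ℝ)) ^ 2 = 4 * s ^ 2 * m := by
            rw [mul_pow, Real.sq_sqrt (Nat.cast_nonneg m)]; ring
          rw [e]
          congr 1
          change _ * meanWidth K + _ = _
          ring
  refine (measure_ge_le_exp_mul_mgf ε hs hint).trans ?_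
  rw [add_assoc, Real.exp_add]
  gcongr

end Recovery

/-! ### Choice of constants and conclusion. -/

theorem corollary1 :
    ∃ C c : ℝ, 0 < C ∧ 0 < c ∧
      ∀ (n m : ℕ) (Ω : Type*) [MeasurableSpace Ω] (μ : Measure Ω) [IsProbabilityMeasure μ]
        (K : Set (EuclideanSpace ℝ (Fin n))) (x : EuclideanSpace ℝ (Fin n)) (θ : ℝ → ℝ)
        (a : Fin m → Ω → EuclideanSpace ℝ (Fin n)) (y : Fin m → Ω → ℝ) (δ : ℝ),
        K ⊆ Metric.closedBall 0 1 →
        x ∈ K →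
        ‖x‖ = 1 →
        OneBitModel μ a y θ x →
        0 < correlation θ →
        0 < δ →
        C * (δ ^ 2)⁻¹ * meanWidth K ^ 2 ≤ (m : ℝ) →
        ∃ E : Set Ω, MeasurableSet E ∧
          1 - 8 * Real.exp (-(c * δ ^ 2 * (m : ℝ))) ≤ μ.real E ∧
          ∀ ω ∈ E, ∀ xhat : EuclideanSpace ℝ (Fin n),
            IsSolution K (fun i => a i ω) (fun i => y i ω) xhat →
              ‖xhat - x‖ ^ 2 ≤ δ / correlation θ := by
  refine ⟨64, 1 / (128 * Real.pi ^ 2), by norm_num, by positivity, ?_⟩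
  intro n m Ω _ μ _ K x θ a y δ hK hxK hx H hθ hδ hwm
  -- For `m = 0` the required probability is at least `1 - 8 < 0`, so the empty event suffices.
  rcases Nat.eq_zero_or_pos m with rfl | hm
  · exact ⟨∅, MeasurableSet.empty, by norm_num, by simp⟩
  have hne : K.Nonempty := ⟨x, hxK⟩
  have hball := sub_self_subset_closedBall hK
  have hcont := continuous_supportFunction (hne.sub hne) hball
  have hWm : Measurable fun ω => supportFunction (K - K)
      (∑ i, (y i ω • a i ω - correlation θ • x)) :=
    hcont.measurable.comp (Finset.measurable_sum _ fun i _ => (H.measurable_smul i).sub_const _)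
  set A : Set Ω := {ω | m * δ / 2 ≤ supportFunction (K - K)
      (∑ i, (y i ω • a i ω - correlation θ • x))} with hA
  have hAm : MeasurableSet A := measurableSet_le measurable_const hWm
  refine ⟨Aᶜ, hAm.compl, ?_, ?_⟩
  · have hw := meanWidth_nonneg hK hne
    -- This is the square root of the hypothesis on `m`, with `C = 64 = 8 ^ 2`. It makes the
    -- mean-width term at most half of the threshold term `s * m * δ / 2`.
    have hwle : 8 * meanWidth K ≤ δ * √m := by
      have h1 : (8 * meanWidth K) ^ 2 ≤ (δ * √m) ^ 2 := by
        rw [mul_pow δ, Real.sq_sqrt (Nat.cast_nonneg m)]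
        have h2 : 64 * meanWidth K ^ 2 / δ ^ 2 ≤ m := by
          rw [div_eq_mul_inv]; linarith
        rw [div_le_iff₀ (by positivity)] at h2
        linarith
      exact le_of_sq_le_sq h1 (by positivity)
    -- This `s` minimizes `-s * δ * m / 4 + 2 * s ^ 2 * π ^ 2 * m`, what is left of the exponent
    -- after the mean width is absorbed. The minimum is `-s * δ * m / 8`, whence `c = 1 / (128 π²)`.
    set s : ℝ := δ / (16 * Real.pi ^ 2) with hs
    have hs0 : 0 ≤ s := by positivity
    have hsπ : s * Real.pi ^ 2 = δ / 16 := by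
      rw [hs]; field_simp
    have htail := H.measureReal_deviation_ge_le hK hne hx hθ hs0 (m * δ / 2)
    have hexp : -s * (m * δ / 2) + 2 * s * √m * meanWidth K + 2 * s ^ 2 * Real.pi ^ 2 * m ≤
        -(1 / (128 * Real.pi ^ 2) * δ ^ 2 * m) := by
      have e1 : 2 * s * √m * meanWidth K ≤ s * δ * m / 4 := by
        have : s * √m * (8 * meanWidth K) ≤ s * √m * (δ * √m) := by gcongr
        have e : s * √m * (δ * √m) = s * δ * m := by
          rw [mul_mul_mul_comm, Real.mul_self_sqrt (Nat.cast_nonneg m)]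
        linarith
      have e2 : 2 * s ^ 2 * Real.pi ^ 2 * m = s * δ * m / 8 := by
        rw [show 2 * s ^ 2 * Real.pi ^ 2 * m = 2 * s * (s * Real.pi ^ 2) * m by ring, hsπ]
        ring
      have e3 : 1 / (128 * Real.pi ^ 2) * δ ^ 2 * m = s * δ * m / 8 := by
        rw [hs]; field_simp; norm_num
      rw [e2, e3]
      linarith
    have hfin := htail.trans (Real.exp_le_exp.2 hexp)
    -- The tail bound has a single exponential, so the factor 8 is slack.
    rw [probReal_compl_eq_one_sub hAm]
    have := Real.exp_pos (-(1 / (128 * Real.pi ^ 2) * δ ^ 2 * m))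
    linarith
  · intro ω hω xhat hsol
    have hlt : supportFunction (K - K) (∑ i, (y i ω • a i ω - correlation θ • x)) ≤ m * δ / 2 := by
      rw [hA, Set.mem_compl_iff, Set.mem_ofPred_eq, not_le] at hω
      exact hω.le
    exact hsol.norm_sub_sq_le hm hθ hK hxK hx hlt
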